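/- Let $\mathbb{K}$ be an algebraically closed field of characteristic $3$ and let $n\ge 1$. Let $$\nu_3:\mathbb{P}^n\to\mathbb{P}^N,\qquad N=\binom{n+3}{3}-1,\qquad [x_0:\dots:x_n]\mapsto[x_0^{a_0}\cdots x_n^{a_n}]_{a_0+\cdots+a_n=3},$$ be the third Veronese embedding, that is, the linearly normal embedding of $\mathbb{P}^n$ defined by $\mathcal{O}_{\mathbb{P}^n}(3)$. Let $I(V_{n,3})$ be the homogeneous ideal of its image $V_{n,3}=\nu_3(\mathbb{P}^n)$ in the homogeneous coordinate ring of $\mathbb{P}^N$. Then the rank index of $(\mathbb{P}^n,\mathcal{O}_{\mathbb{P}^n}(3))$ is $3$, that is, the smallest integer $k$ such that $I(V_{n,3})$ is generated by quadratic forms of rank at most $k$ is $k=3$. Here the rank of a quadratic form is the rank of its associated symmetric matrix. -/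

import Mathlib

open scoped LinearAlgebra.Projectivization

noncomputable section

/-- The set `A(n,d)` of exponent vectors `I = (a₀, …, aₙ)` of natural numbers with
`a₀ + ⋯ + aₙ = d`. It indexes the homogeneous coordinates `z_I` of `ℙ^N`,
`N = binom (n+d) n - 1`. -/
abbrev VeroneseIndex (n d : ℕ) : Type :=
  {I : Fin (n + 1) → ℕ // ∑ i, I i = d}

instance VeroneseIndex.instFintype (n d : ℕ) : Fintype (VeroneseIndex n d) :=
  Fintype.subtype (Finset.piAntidiag Finset.univ d) (fun I => by simp)

/-- The vector of all monomials of degree `d` in the coordinates of `v`. -/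
def veroneseVec {K : Type*} [Field K] (n d : ℕ) (v : Fin (n + 1) → K) :
    VeroneseIndex n d → K :=
  fun I => ∏ i, v i ^ I.1 i

theorem veroneseVec_ne_zero {K : Type*} [Field K] (n d : ℕ) {v : Fin (n + 1) → K}
    (hv : v ≠ 0) : veroneseVec n d v ≠ 0 := by
  obtain ⟨i, hi⟩ := Function.ne_iff.mp hv
  intro h
  have h1 := congrFun h ⟨Pi.single i d, by simp⟩
  have h2 : ∏ j, v j ^ (Pi.single i d : Fin (n + 1) → ℕ) j = v i ^ d := by
    rw [Finset.prod_eq_single i]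
    · simp
    · intro j _ hj
      simp [Pi.single_eq_of_ne hj]
    · simp
  simp only [veroneseVec, h2, Pi.zero_apply] at h1
  exact pow_ne_zero d hi h1

theorem veroneseVec_smul {K : Type*} [Field K] (n d : ℕ) (t : K) (v : Fin (n + 1) → K) :
    veroneseVec n d (t • v) = t ^ d • veroneseVec n d v := by
  funext I
  simp only [veroneseVec, Pi.smul_apply, smul_eq_mul, mul_pow, Finset.prod_mul_distrib,
    Finset.prod_pow_eq_pow_sum, I.2]

/-- The `d`-th Veronese map `ν_d : ℙ^n → ℙ^N`, `[x] ↦ [x^I]_{I ∈ A(n,d)}`, that is, the map given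
by the complete linear system of `𝒪(d)` on `ℙ^n`. -/
def veroneseMap (K : Type*) [Field K] (n d : ℕ) :
    ℙ K (Fin (n + 1) → K) → ℙ K (VeroneseIndex n d → K) :=
  Projectivization.lift
    (fun v => Projectivization.mk K (veroneseVec n d v.1) (veroneseVec_ne_zero n d v.2))
    (by
      rintro ⟨v, hv⟩ ⟨w, hw⟩ t (rfl : v = t • w)
      exact (Projectivization.mk_eq_mk_iff' K _ _ _ _).2
        ⟨t ^ d, (veroneseVec_smul n d t w).symm⟩)

/-- The Veronese variety `V_{n,d} = ν_d(ℙ^n) ⊆ ℙ^N`. -/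
def veroneseVariety (K : Type*) [Field K] (n d : ℕ) : Set (ℙ K (VeroneseIndex n d → K)) :=
  Set.range (veroneseMap K n d)

/-- The homogeneous ideal `I(X)` of a subset `X` of a projective space: the ideal generated by
the homogeneous polynomials that vanish at every point of `X` (at every vector of homogeneous
coordinates of every point of `X`). -/
def homogeneousIdealOf {K ι : Type*} [Field K] (X : Set (ℙ K (ι → K))) :
    Ideal (MvPolynomial ι K) :=
  Ideal.span {F | (∃ e : ℕ, F.IsHomogeneous e) ∧
    ∀ (v : ι → K) (hv : v ≠ 0), Projectivization.mk K v hv ∈ X → MvPolynomial.eval v F = 0}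

/-- The symmetric matrix of a quadratic form `Q` over a field of characteristic different
from `2`: the diagonal entries are the coefficients of the squares `z_i ^ 2`, the off-diagonal ones
are half the coefficients of the products `z_i z_j`. -/
def quadricMatrix {K ι : Type*} [Field K] [DecidableEq ι] (Q : MvPolynomial ι K) :
    Matrix ι ι K :=
  Matrix.of fun i j =>
    if i = j then Q.coeff (Finsupp.single i 2)
    else Q.coeff (Finsupp.single i 1 + Finsupp.single j 1) / 2

/-- The rank of a quadratic form over a field of characteristic different from `2`. -/
def quadricRank {K ι : Type*} [Field K] [Fintype ι] [DecidableEq ι] (Q : MvPolynomial ι K) : ℕ :=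
  (quadricMatrix Q).rank

/-- Property `QR(k)` of a subset `X` of a projective space: the homogeneous ideal of `X` is
generated by quadratic forms of rank at most `k`. -/
def PropertyQR {K ι : Type*} [Field K] [Fintype ι] [DecidableEq ι] (X : Set (ℙ K (ι → K)))
    (k : ℕ) : Prop :=
  ∃ S : Set (MvPolynomial ι K),
    (∀ Q ∈ S, Q.IsHomogeneous 2 ∧ quadricRank Q ≤ k) ∧ homogeneousIdealOf X = Ideal.span S

/-- `k` is the rank index of `X`: the minimal integer such that `X` satisfies property `QR(k)`.
(In particular the homogeneous ideal of `X` is then generated by quadratic forms.) -/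
def HasRankIndex {K ι : Type*} [Field K] [Fintype ι] [DecidableEq ι] (X : Set (ℙ K (ι → K)))
    (k : ℕ) : Prop :=
  IsLeast {m : ℕ | PropertyQR X m} k

end

open MvPolynomial

/-! The ideal is the kernel of the monomial map `veroneseHom`, and for linear forms s, t, h it
contains the quadrics z_{s²h} z_{t²h} - z_{sth}², of rank at most 3. The point is that in
characteristic 3 these generate it.

Six linear forms split into two triples in ten ways, each splitting giving a product of two forms z.
Polarizing the quadrics yields, for each pair {h, h'} among the six, a relation between the six
splittings that separate h from h'. Its coefficients are 4, 4, -2, -2, -2, -2, and all become 1 in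
characteristic 3. This symmetry makes all ten splittings congruent (`split_sub_sum_mem`,
`exchange_mem`). Hence modulo the quadrics a monomial of degree e, viewed as an e × 3 tableau of
variables, is unchanged by any permutation of cells and depends only on its image under
`veroneseHom`; so the kernel is no larger than the ideal of the quadrics
(`mem_of_veroneseHom_eq_zero`).

For minimality, a quadric of rank at most 2 over an algebraically closed field is a product of two
linear forms. The kernel is prime and contains no nonzero linear form, so no nonzero quadric of rank
at most 2 lies in it (`eq_zero_of_quadricRank_le_two`), while for n ≥ 1 the ideal is not zero. -/

/-- The linear form with given coefficients. -/
noncomputable def linForm (K : Type*) {ι : Type*} [Field K] [Fintype ι] :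
    (ι → K) →ₗ[K] MvPolynomial ι K :=
  Fintype.linearCombination K X

/-- The linear map sending a polynomial `p` to the linear form `∑ p_I z_I`, where `p_I` is the
coefficient of `x^I` in `p`. -/
noncomputable def formOf (K : Type*) [Field K] (n d : ℕ) :
    MvPolynomial (Fin (n + 1)) K →ₗ[K] MvPolynomial (VeroneseIndex n d) K :=
  linForm K ∘ₗ LinearMap.pi fun I => lcoeff K (Finsupp.equivFunOnFinite.symm I.1)

/-- The quadric `z_{s²h} z_{t²h} - z_{sth}²`. -/
noncomputable def rankThreeQuadric {K : Type*} [Field K] {n : ℕ}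
    (s t h : MvPolynomial (Fin (n + 1)) K) : MvPolynomial (VeroneseIndex n 3) K :=
  formOf K n 3 (s * s * h) * formOf K n 3 (t * t * h) - formOf K n 3 (s * t * h) ^ 2

/-! ### Exchange relations obtained by polarization. -/

section Exchange

variable {K : Type*} [Field K] {n : ℕ} {J : Ideal (MvPolynomial (VeroneseIndex n 3) K)}
  {V : Submodule K (MvPolynomial (Fin (n + 1)) K)}

/-- The quadric is quadratic in each of h, s and t. Taking the difference Q(x + y) - Q(x) - Q(y) in
each variable in turn stays in `J` and needs no division. -/
theorem polarization_mem
    (hJ : ∀ s ∈ V, ∀ t ∈ V, ∀ h ∈ V, rankThreeQuadric s t h ∈ J)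
    {s s' t t' h h' : MvPolynomial (Fin (n + 1)) K} (hs : s ∈ V) (hs' : s' ∈ V) (ht : t ∈ V)
    (ht' : t' ∈ V) (hh : h ∈ V) (hh' : h' ∈ V) :
    4 * (formOf K n 3 (s * s' * h) * formOf K n 3 (t * t' * h')
        + formOf K n 3 (s * s' * h') * formOf K n 3 (t * t' * h))
      - 2 * (formOf K n 3 (s * t * h) * formOf K n 3 (s' * t' * h')
        + formOf K n 3 (s * t' * h) * formOf K n 3 (s' * t * h')
        + formOf K n 3 (s' * t * h) * formOf K n 3 (s * t' * h')
        + formOf K n 3 (s' * t' * h) * formOf K n 3 (s * t * h')) ∈ J := by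
  set φ := formOf K n 3 with hφ
  have h1 : ∀ {s t}, s ∈ V → t ∈ V →
      φ (s * s * h) * φ (t * t * h') + φ (s * s * h') * φ (t * t * h)
        - 2 * (φ (s * t * h) * φ (s * t * h')) ∈ J := by
    intro s t hs ht
    have := J.sub_mem (J.sub_mem (hJ s hs t ht _ (V.add_mem hh hh')) (hJ s hs t ht h hh))
      (hJ s hs t ht h' hh')
    convert this using 1
    simp only [rankThreeQuadric, mul_add, map_add, ← hφ]
    ring
  have h2 : ∀ {t}, t ∈ V →
      2 * (φ (s * s' * h) * φ (t * t * h') + φ (s * s' * h') * φ (t * t * h))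
        - 2 * (φ (s * t * h) * φ (s' * t * h') + φ (s' * t * h) * φ (s * t * h')) ∈ J := by
    intro t ht
    have := J.sub_mem (J.sub_mem (h1 (V.add_mem hs hs') ht) (h1 hs ht)) (h1 hs' ht)
    convert this using 1
    simp only [mul_add, add_mul, map_add, mul_comm s' s]
    ring
  have := J.sub_mem (J.sub_mem (h2 (V.add_mem ht ht')) (h2 ht)) (h2 ht')
  convert this using 1
  simp only [mul_add, add_mul, map_add, mul_comm t' t]
  ring

/-- Since 4 = -2 = 1, the relation becomes the plain sum of all splittings separating `h` from `h'`,
symmetric in the other four forms. -/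
theorem polarization_mem_of_charP [CharP K 3]
    (hJ : ∀ s ∈ V, ∀ t ∈ V, ∀ h ∈ V, rankThreeQuadric s t h ∈ J)
    {s s' t t' h h' : MvPolynomial (Fin (n + 1)) K} (hs : s ∈ V) (hs' : s' ∈ V) (ht : t ∈ V)
    (ht' : t' ∈ V) (hh : h ∈ V) (hh' : h' ∈ V) :
    formOf K n 3 (s * s' * h) * formOf K n 3 (t * t' * h')
      + formOf K n 3 (s * s' * h') * formOf K n 3 (t * t' * h)
      + formOf K n 3 (s * t * h) * formOf K n 3 (s' * t' * h')
      + formOf K n 3 (s * t' * h) * formOf K n 3 (s' * t * h')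
      + formOf K n 3 (s' * t * h) * formOf K n 3 (s * t' * h')
      + formOf K n 3 (s' * t' * h) * formOf K n 3 (s * t * h') ∈ J := by
  have h3 : (3 : MvPolynomial (VeroneseIndex n 3) K) = 0 := by
    exact_mod_cast CharP.cast_eq_zero (MvPolynomial (VeroneseIndex n 3) K) 3
  convert polarization_mem hJ hs hs' ht ht' hh hh' using 1
  linear_combination (-(formOf K n 3 (s * s' * h) * formOf K n 3 (t * t' * h')
      + formOf K n 3 (s * s' * h') * formOf K n 3 (t * t' * h))
      + formOf K n 3 (s * t * h) * formOf K n 3 (s' * t' * h')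
      + formOf K n 3 (s * t' * h) * formOf K n 3 (s' * t * h')
      + formOf K n 3 (s' * t * h) * formOf K n 3 (s * t' * h')
      + formOf K n 3 (s' * t' * h) * formOf K n 3 (s * t * h')) * h3

/-- In characteristic `3`, a splitting of six linear forms into two triples is congruent to the
sum of all ten splittings. -/
theorem split_sub_sum_mem [CharP K 3]
    (hJ : ∀ s ∈ V, ∀ t ∈ V, ∀ h ∈ V, rankThreeQuadric s t h ∈ J)
    {a b c d e f : MvPolynomial (Fin (n + 1)) K} (ha : a ∈ V) (hb : b ∈ V) (hc : c ∈ V)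
    (hd : d ∈ V) (he : e ∈ V) (hf : f ∈ V) :
    formOf K n 3 (a * b * c) * formOf K n 3 (d * e * f) -
      (formOf K n 3 (a * b * c) * formOf K n 3 (d * e * f)
      + formOf K n 3 (a * b * d) * formOf K n 3 (c * e * f)
      + formOf K n 3 (a * b * e) * formOf K n 3 (c * d * f)
      + formOf K n 3 (a * b * f) * formOf K n 3 (c * d * e)
      + formOf K n 3 (a * c * d) * formOf K n 3 (b * e * f)
      + formOf K n 3 (a * c * e) * formOf K n 3 (b * d * f)
      + formOf K n 3 (a * c * f) * formOf K n 3 (b * d * e)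
      + formOf K n 3 (a * d * e) * formOf K n 3 (b * c * f)
      + formOf K n 3 (a * d * f) * formOf K n 3 (b * c * e)
      + formOf K n 3 (a * e * f) * formOf K n 3 (b * c * d)) ∈ J := by
  have h3 : (3 : MvPolynomial (VeroneseIndex n 3) K) = 0 := by
    exact_mod_cast CharP.cast_eq_zero (MvPolynomial (VeroneseIndex n 3) K) 3
  -- Sum over the nine pairs with one form from {a, b, c} and one from {d, e, f}. The splitting
  -- abc|def separates all nine pairs, every other splitting separates five; modulo 3 the
  -- coefficients 9 and 5 are 0 and -1.
  have key := J.add_mem (J.add_mem (J.add_mem (J.add_mem (J.add_mem (J.add_mem (J.add_mem (J.add_mem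
    (polarization_mem_of_charP hJ hb hc he hf ha hd)
    (polarization_mem_of_charP hJ hb hc hd hf ha he))
    (polarization_mem_of_charP hJ hb hc hd he ha hf))
    (polarization_mem_of_charP hJ ha hc he hf hb hd))
    (polarization_mem_of_charP hJ ha hc hd hf hb he))
    (polarization_mem_of_charP hJ ha hc hd he hb hf))
    (polarization_mem_of_charP hJ ha hb he hf hc hd))
    (polarization_mem_of_charP hJ ha hb hd hf hc he))
    (polarization_mem_of_charP hJ ha hb hd he hc hf)
  convert key using 1
  simp only [show b * c * a = a * b * c by ring,
    show b * e * a = a * b * e by ring, show b * f * a = a * b * f by ring,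
    show c * e * a = a * c * e by ring, show c * f * a = a * c * f by ring,
    show b * d * a = a * b * d by ring, show c * d * a = a * c * d by ring,
    show e * f * a = a * e * f by ring, show d * f * a = a * d * f by ring,
    show d * e * a = a * d * e by ring, show e * f * d = d * e * f by ring,
    show e * f * b = b * e * f by ring, show d * f * b = b * d * f by ring,
    show d * e * b = b * d * e by ring, show e * f * c = c * e * f by ring,
    show d * f * c = c * d * f by ring, show d * e * c = c * d * e by ring,
    show a * c * b = a * b * c by ring, show a * e * b = a * b * e by ring,
    show a * f * b = a * b * f by ring, show a * d * b = a * b * d by ring,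
    show c * e * b = b * c * e by ring, show c * f * b = b * c * f by ring,
    show c * d * b = b * c * d by ring, show b * e * d = b * d * e by ring,
    show b * f * d = b * d * f by ring, show c * e * d = c * d * e by ring,
    show c * f * d = c * d * f by ring, show b * f * e = b * e * f by ring,
    show c * f * e = c * e * f by ring, show d * f * e = d * e * f by ring,
    show a * e * d = a * d * e by ring, show a * f * d = a * d * f by ring,
    show a * f * e = a * e * f by ring, show a * e * c = a * c * e by ring,
    show a * f * c = a * c * f by ring, show a * d * c = a * c * d by ring,
    show b * e * c = b * c * e by ring, show b * f * c = b * c * f by ring,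
    show b * d * c = b * c * d by ring]
  linear_combination (-3 * (formOf K n 3 (a * b * c) * formOf K n 3 (d * e * f))
      - 2 * (formOf K n 3 (a * b * d) * formOf K n 3 (c * e * f)
      + formOf K n 3 (a * b * e) * formOf K n 3 (c * d * f)
      + formOf K n 3 (a * b * f) * formOf K n 3 (c * d * e)
      + formOf K n 3 (a * c * d) * formOf K n 3 (b * e * f)
      + formOf K n 3 (a * c * e) * formOf K n 3 (b * d * f)
      + formOf K n 3 (a * c * f) * formOf K n 3 (b * d * e)
      + formOf K n 3 (a * d * e) * formOf K n 3 (b * c * f)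
      + formOf K n 3 (a * d * f) * formOf K n 3 (b * c * e)
      + formOf K n 3 (a * e * f) * formOf K n 3 (b * c * d))) * h3

/-- In characteristic `3`, exchanging linear forms between two triples is a congruence modulo the
quadrics `z_{s²h} z_{t²h} - z_{sth}²`. -/
theorem exchange_mem [CharP K 3]
    (hJ : ∀ s ∈ V, ∀ t ∈ V, ∀ h ∈ V, rankThreeQuadric s t h ∈ J)
    {a b c d e f : MvPolynomial (Fin (n + 1)) K} (ha : a ∈ V) (hb : b ∈ V) (hc : c ∈ V)
    (hd : d ∈ V) (he : e ∈ V) (hf : f ∈ V) :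
    formOf K n 3 (a * (b * c)) * formOf K n 3 (d * (e * f)) -
      formOf K n 3 (d * (b * c)) * formOf K n 3 (a * (e * f)) ∈ J := by
  -- The sum of all ten splittings does not depend on the order of the six forms, so it cancels in
  -- the difference.
  have := J.sub_mem (split_sub_sum_mem hJ hb hc ha hd he hf)
    (split_sub_sum_mem hJ hb hc hd ha he hf)
  convert this using 1
  simp only [show b * c * a = a * (b * c) by ring, show b * c * d = d * (b * c) by ring,
    show d * e * f = d * (e * f) by ring, show a * e * f = a * (e * f) by ring,
    show b * a * d = b * d * a by ring, show c * a * d = c * d * a by ring,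
    show d * a * e = a * d * e by ring, show d * a * f = a * d * f by ring]
  ring

end Exchange

/-! ### The vanishing ideal and the kernel of the monomial map. -/

/-- The polynomial map `z_I ↦ x^I`. -/
noncomputable def veroneseHom (K : Type*) [Field K] (n d : ℕ) :
    MvPolynomial (VeroneseIndex n d) K →ₐ[K] MvPolynomial (Fin (n + 1)) K :=
  aeval fun I => monomial (Finsupp.equivFunOnFinite.symm I.1) 1

theorem eval_veroneseHom {K : Type*} [Field K] {n d : ℕ} (w : Fin (n + 1) → K)
    (F : MvPolynomial (VeroneseIndex n d) K) :
    eval w (veroneseHom K n d F) = eval (veroneseVec n d w) F := by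
  induction F using MvPolynomial.induction_on with
  | C a => simp [veroneseHom]
  | add p q hp hq => simp [hp, hq]
  | mul_X p i hp =>
    simp only [map_mul, hp, eval_X]
    simp [veroneseHom, eval_monomial, veroneseVec, Finsupp.prod_fintype]

theorem formOf_monomial {K : Type*} [Field K] {n d : ℕ} (I : VeroneseIndex n d) (c : K) :
    formOf K n d (monomial (Finsupp.equivFunOnFinite.symm I.1) c) = C c * X I := by
  classical
  simp [formOf, linForm, Fintype.linearCombination_apply, coeff_monomial, ite_smul,
    MvPolynomial.smul_eq_C_mul]
  rw [Finset.sum_eq_single I]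
  · simp
  · intro b _ hb
    rw [if_neg]; exact fun h => hb (Subtype.ext h.symm)
  · simp

theorem veroneseHom_formOf {K : Type*} [Field K] {n d : ℕ} {p : MvPolynomial (Fin (n + 1)) K}
    (hp : p.IsHomogeneous d) : veroneseHom K n d (formOf K n d p) = p := by
  conv_lhs => rw [p.as_sum]
  conv_rhs => rw [p.as_sum]
  simp only [map_sum]
  refine Finset.sum_congr rfl fun m hm => ?_
  have hd : ∑ i, m i = d := by
    rw [← Finsupp.degree_eq_sum]; exact (hp.degree_eq_sum_deg_support hm).symm
  have := formOf_monomial (K := K) (⟨m, hd⟩ : VeroneseIndex n d) (coeff m p)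
  simp only [Finsupp.equivFunOnFinite_symm_coe] at this
  rw [this]
  simp [veroneseHom, MvPolynomial.algebraMap_eq, C_mul_monomial]

theorem mk_mem_veroneseVariety {K : Type*} [Field K] {n d : ℕ} {w : Fin (n + 1) → K}
    (hw : w ≠ 0) :
    Projectivization.mk K (veroneseVec n d w) (veroneseVec_ne_zero n d hw) ∈
      veroneseVariety K n d :=
  ⟨Projectivization.mk K w hw, rfl⟩

/-- The scalar between two representatives has a d-th root, which can be absorbed into the source
vector. -/
theorem exists_veroneseVec_eq {K : Type*} [Field K] [IsAlgClosed K] {n d : ℕ} (hd : d ≠ 0)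
    {v : VeroneseIndex n d → K} (hv : v ≠ 0)
    (h : Projectivization.mk K v hv ∈ veroneseVariety K n d) :
    ∃ w, veroneseVec n d w = v := by
  obtain ⟨p, hp⟩ := h
  induction p using Projectivization.ind with
  | h w hw =>
    have hp' : Projectivization.mk K (veroneseVec n d w) (veroneseVec_ne_zero n d hw) =
      Projectivization.mk K v hv := hp
    obtain ⟨a, ha⟩ := (Projectivization.mk_eq_mk_iff' K _ _ _ _).1 hp'.symm
    obtain ⟨t, rfl⟩ := IsAlgClosed.exists_pow_nat_eq a (Nat.pos_of_ne_zero hd)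
    exact ⟨t • w, by rw [veroneseVec_smul, ha]⟩

theorem veroneseHom_eq_zero_iff {K : Type*} [Field K] [IsAlgClosed K] {n d : ℕ} (hd : d ≠ 0)
    (F : MvPolynomial (VeroneseIndex n d) K) :
    veroneseHom K n d F = 0 ↔ ∀ (v : VeroneseIndex n d → K) (hv : v ≠ 0),
      Projectivization.mk K v hv ∈ veroneseVariety K n d → eval v F = 0 := by
  constructor
  · intro h v hv hmem
    obtain ⟨w, rfl⟩ := exists_veroneseVec_eq hd hv hmem
    rw [← eval_veroneseHom, h, map_zero]
  · intro h
    -- The hypothesis gives nothing at `w = 0`; the factor `X 0` vanishes there, so the product is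
    -- zero as a function on an infinite field.
    have : X 0 * veroneseHom K n d F = 0 := by
      refine MvPolynomial.funext fun w => ?_
      by_cases hw : w = 0
      · simp [hw]
      · rw [map_mul, eval_veroneseHom, h _ _ (mk_mem_veroneseVariety hw)]; simp
    exact (mul_eq_zero.1 this).resolve_left (X_ne_zero 0)

theorem homogeneousIdealOf_le_ker {K : Type*} [Field K] [IsAlgClosed K] {n d : ℕ} (hd : d ≠ 0) :
    homogeneousIdealOf (veroneseVariety K n d) ≤ RingHom.ker (veroneseHom K n d) :=
  Ideal.span_le.2 fun _ hF => (veroneseHom_eq_zero_iff hd _).2 hF.2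

/-! ### Monomials as tableaux of variables. -/

theorem exists_monomial_eq_prod_X {K σ : Type*} [CommSemiring K] {e : ℕ} (m : σ →₀ ℕ)
    (hm : m.degree = e) :
    ∃ g : Fin e → σ, (monomial m 1 : MvPolynomial σ K) = ∏ i, X (g i) := by
  induction e generalizing m with
  | zero =>
    rw [Finsupp.degree_eq_zero_iff] at hm
    subst hm
    exact ⟨Fin.elim0, by simp⟩
  | succ e ih =>
    have hne : m ≠ 0 := by rintro rfl; simp at hm
    obtain ⟨i, hi⟩ := Finsupp.ne_iff.1 hne
    have hle : Finsupp.single i 1 ≤ m := Finsupp.single_le_iff.2 (Nat.one_le_iff_ne_zero.2 hi)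
    obtain ⟨m', rfl⟩ := exists_add_of_le hle
    obtain ⟨g, hg⟩ := ih m' (by rw [map_add, Finsupp.degree_single] at hm; omega)
    refine ⟨Fin.cons i g, ?_⟩
    rw [Fin.prod_univ_succ]
    simp only [Fin.cons_zero, Fin.cons_succ]
    rw [← hg, X, monomial_mul, one_mul]

theorem prod_X_eq_monomial {K σ α : Type*} [CommSemiring K] [Fintype α] (f : α → σ) :
    ∏ p, (X (f p) : MvPolynomial σ K) = monomial (∑ p, Finsupp.single (f p) 1) 1 := by
  rw [monomial_sum_one]; rfl

/-- Comparing exponents, `f` and `g` have fibres of equal size over every variable; bijections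
between the fibres glue to a permutation. -/
theorem exists_perm_of_prod_X_eq {K σ α : Type*} [CommSemiring K] [Nontrivial K] [Fintype α]
    {f g : α → σ} (h : ∏ p, (X (f p) : MvPolynomial σ K) = ∏ p, X (g p)) :
    ∃ s : Equiv.Perm α, f = g ∘ s := by
  classical
  rw [prod_X_eq_monomial, prod_X_eq_monomial, monomial_left_inj one_ne_zero] at h
  have hc : ∀ c, Fintype.card {a // f a = c} = Fintype.card {a // g a = c} := by
    intro c
    have := DFunLike.congr_fun h c
    simpa [Finsupp.finsetSum_apply, Finsupp.single_apply, Fintype.card_subtype] using this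
  refine ⟨Equiv.ofFiberEquiv fun c => Fintype.equivOfCardEq (hc c), funext fun a => ?_⟩
  exact (Equiv.ofFiberEquiv_map _ a).symm

/-- The product of the coordinates `z_{x_a x_b x_c}` over the rows of a tableau of variables. -/
noncomputable def tableauProd (K : Type*) [Field K] {n d e : ℕ} (f : Fin e × Fin d → Fin (n + 1)) :
    MvPolynomial (VeroneseIndex n d) K :=
  ∏ i, formOf K n d (∏ a, X (f (i, a)))

theorem isHomogeneous_prod_X {K σ : Type*} [CommSemiring K] {d : ℕ} (x : Fin d → σ) :
    (∏ a, (X (x a) : MvPolynomial σ K)).IsHomogeneous d := by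
  simpa using IsHomogeneous.prod Finset.univ (fun a => (X (x a) : MvPolynomial σ K))
    (fun _ => 1) fun a _ => isHomogeneous_X K (x a)

theorem veroneseHom_tableauProd {K : Type*} [Field K] {n d e : ℕ}
    (f : Fin e × Fin d → Fin (n + 1)) : veroneseHom K n d (tableauProd K f) = ∏ p, X (f p) := by
  rw [tableauProd, map_prod, Fintype.prod_prod_type]
  exact Finset.prod_congr rfl fun i _ =>
    veroneseHom_formOf (isHomogeneous_prod_X fun a => f (i, a))

theorem exists_monomial_eq_tableauProd {K : Type*} [Field K] {n d e : ℕ}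
    (m : VeroneseIndex n d →₀ ℕ) (hm : m.degree = e) :
    ∃ f : Fin e × Fin d → Fin (n + 1), monomial m 1 = tableauProd K f := by
  obtain ⟨g, hg⟩ := exists_monomial_eq_prod_X (K := K) m hm
  have h : ∀ i, ∃ x : Fin d → Fin (n + 1),
      (monomial (Finsupp.equivFunOnFinite.symm (g i).1) 1 : MvPolynomial (Fin (n + 1)) K) =
        ∏ a, X (x a) := fun i =>
    exists_monomial_eq_prod_X _ (by rw [Finsupp.degree_eq_sum]; exact (g i).2)
  choose x hx using h
  refine ⟨fun p => x p.1 p.2, ?_⟩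
  rw [hg, tableauProd]
  refine Finset.prod_congr rfl fun i _ => ?_
  rw [← hx, formOf_monomial, C_1, one_mul]

/-- Isolates one entry of a row. The cofactor is the same for every `y`, so it serves both before
and after a swap. -/
theorem prod_fin_three_split {M : Type*} [CommMonoid M] {α : Type*} (φ : α → M) (u : Fin 3 → α)
    (a : Fin 3) : ∃ b c, ∀ y, ∏ k, φ (Function.update u a y k) = φ y * (φ b * φ c) := by
  fin_cases a
  · exact ⟨u 1, u 2, fun y => by simp [Fin.prod_univ_three, mul_assoc]⟩
  · exact ⟨u 0, u 2, fun y => by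
      simp [Fin.prod_univ_three, mul_comm (φ (u 0)) (φ y), mul_assoc]⟩
  · exact ⟨u 0, u 1, fun y => by simp [Fin.prod_univ_three, mul_comm]⟩

section

variable {K : Type*} [Field K] {n : ℕ} {J : Ideal (MvPolynomial (VeroneseIndex n 3) K)}

/-- A swap inside one row only reorders a product; a swap between two rows is `exchange_mem` times
the product of the remaining rows. -/
theorem mk_tableauProd_swap [CharP K 3]
    (hJ : ∀ s ∈ homogeneousSubmodule (Fin (n + 1)) K 1,
      ∀ t ∈ homogeneousSubmodule (Fin (n + 1)) K 1,
      ∀ h ∈ homogeneousSubmodule (Fin (n + 1)) K 1, rankThreeQuadric s t h ∈ J)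
    {e : ℕ} (f : Fin e × Fin 3 → Fin (n + 1)) (p q : Fin e × Fin 3) :
    Ideal.Quotient.mk J (tableauProd K (f ∘ Equiv.swap p q)) =
      Ideal.Quotient.mk J (tableauProd K f) := by
  obtain ⟨i, a⟩ := p
  obtain ⟨j, b⟩ := q
  by_cases hij : i = j
  · subst hij
    refine congrArg (Ideal.Quotient.mk J) (Finset.prod_congr rfl fun k _ =>
      congrArg (formOf K n 3) ?_)
    by_cases hk : k = i
    · subst hk
      rw [← Equiv.prod_comp (Equiv.swap a b) fun c => X (f (k, c))]
      refine Finset.prod_congr rfl fun c _ => ?_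
      simp only [Function.comp_apply, Equiv.swap_apply_def, Prod.mk.injEq, true_and]
      split_ifs <;> simp_all
    · refine Finset.prod_congr rfl fun c _ => ?_
      rw [Function.comp_apply, Equiv.swap_apply_of_ne_of_ne] <;> simp [hk]
  · obtain ⟨b₁, b₂, hb⟩ := prod_fin_three_split
      (X : Fin (n + 1) → MvPolynomial (Fin (n + 1)) K) (fun c => f (i, c)) a
    obtain ⟨c₁, c₂, hc⟩ := prod_fin_three_split
      (X : Fin (n + 1) → MvPolynomial (Fin (n + 1)) K) (fun c => f (j, c)) b
    have hji : j ∈ Finset.univ.erase i := by simp [Ne.symm hij]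
    have hfi : ∏ c, (X (f (i, c)) : MvPolynomial (Fin (n + 1)) K) =
        X (f (i, a)) * (X b₁ * X b₂) := by
      rw [← hb]; simp
    have hfj : ∏ c, (X (f (j, c)) : MvPolynomial (Fin (n + 1)) K) =
        X (f (j, b)) * (X c₁ * X c₂) := by
      rw [← hc]; simp
    have hgi : ∏ c, (X ((f ∘ Equiv.swap (i, a) (j, b)) (i, c)) : MvPolynomial (Fin (n + 1)) K) =
        X (f (j, b)) * (X b₁ * X b₂) := by
      rw [← hb]
      refine Finset.prod_congr rfl fun c _ => congrArg _ ?_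
      by_cases h : c = a
      · subst h; simp
      · rw [Function.comp_apply, Equiv.swap_apply_of_ne_of_ne] <;> simp [h, hij]
    have hgj : ∏ c, (X ((f ∘ Equiv.swap (i, a) (j, b)) (j, c)) : MvPolynomial (Fin (n + 1)) K) =
        X (f (i, a)) * (X c₁ * X c₂) := by
      rw [← hc]
      refine Finset.prod_congr rfl fun c _ => congrArg _ ?_
      by_cases h : c = b
      · subst h; simp
      · rw [Function.comp_apply, Equiv.swap_apply_of_ne_of_ne] <;> simp [h, Ne.symm hij]
    have hX : ∀ k, (X k : MvPolynomial (Fin (n + 1)) K) ∈ homogeneousSubmodule _ K 1 :=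
      fun k => isHomogeneous_X K k
    have hrest : ∏ k ∈ (Finset.univ.erase i).erase j,
          formOf K n 3 (∏ c, X ((f ∘ Equiv.swap (i, a) (j, b)) (k, c))) =
        ∏ k ∈ (Finset.univ.erase i).erase j, formOf K n 3 (∏ c, X (f (k, c))) := by
      refine Finset.prod_congr rfl fun k hk => congrArg _ (Finset.prod_congr rfl fun c _ => ?_)
      simp only [Finset.mem_erase, Finset.mem_univ, and_true] at hk
      rw [Function.comp_apply, Equiv.swap_apply_of_ne_of_ne] <;> simp [hk]
    rw [Ideal.Quotient.eq, tableauProd, tableauProd,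
      ← Finset.mul_prod_erase _ _ (Finset.mem_univ i), ← Finset.mul_prod_erase _ _ hji,
      ← Finset.mul_prod_erase Finset.univ (fun k => formOf K n 3 (∏ c, X (f (k, c))))
        (Finset.mem_univ i),
      ← Finset.mul_prod_erase _ (fun k => formOf K n 3 (∏ c, X (f (k, c)))) hji,
      hrest, hfi, hfj, hgi, hgj]
    convert J.mul_mem_right
      (∏ k ∈ (Finset.univ.erase i).erase j, formOf K n 3 (∏ c, X (f (k, c))))
      (exchange_mem hJ (hX (f (j, b))) (hX b₁) (hX b₂) (hX (f (i, a))) (hX c₁) (hX c₂)) using 1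
    rw [sub_mul, mul_assoc, mul_assoc]

theorem mk_tableauProd_comp_perm [CharP K 3]
    (hJ : ∀ s ∈ homogeneousSubmodule (Fin (n + 1)) K 1,
      ∀ t ∈ homogeneousSubmodule (Fin (n + 1)) K 1,
      ∀ h ∈ homogeneousSubmodule (Fin (n + 1)) K 1, rankThreeQuadric s t h ∈ J)
    {e : ℕ} (f : Fin e × Fin 3 → Fin (n + 1)) (s : Equiv.Perm (Fin e × Fin 3)) :
    Ideal.Quotient.mk J (tableauProd K (f ∘ s)) = Ideal.Quotient.mk J (tableauProd K f) := by
  induction s using Equiv.Perm.swap_induction_on' with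
  | one => simp
  | mul_swap s p q _ ih =>
    rw [Equiv.Perm.coe_mul, ← Function.comp_assoc, mk_tableauProd_swap hJ, ih]

/-- In characteristic `3`, the quadrics `z_{s²h} z_{t²h} - z_{sth}²` generate the toric ideal. -/
theorem mem_of_veroneseHom_eq_zero [CharP K 3]
    (hJ : ∀ s ∈ homogeneousSubmodule (Fin (n + 1)) K 1,
      ∀ t ∈ homogeneousSubmodule (Fin (n + 1)) K 1,
      ∀ h ∈ homogeneousSubmodule (Fin (n + 1)) K 1, rankThreeQuadric s t h ∈ J)
    {e : ℕ} {F : MvPolynomial (VeroneseIndex n 3) K} (hF : F.IsHomogeneous e)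
    (h0 : veroneseHom K n 3 F = 0) : F ∈ J := by
  classical
  -- A section on monomials of degree 3e. The chosen tableau is irrelevant by permutation
  -- invariance, and the value 0 on other monomials is never used.
  let r : (Fin (n + 1) →₀ ℕ) → MvPolynomial (VeroneseIndex n 3) K ⧸ J := fun u =>
    if h : ∃ f : Fin e × Fin 3 → Fin (n + 1),
        ∏ p, (X (f p) : MvPolynomial (Fin (n + 1)) K) = monomial u 1
    then Ideal.Quotient.mk J (tableauProd K h.choose) else 0
  let T := (basisMonomials (Fin (n + 1)) K).constr K r
  have hT : ∀ f : Fin e × Fin 3 → Fin (n + 1),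
      T (∏ p, X (f p)) = Ideal.Quotient.mk J (tableauProd K f) := by
    intro f
    have hex : ∃ g : Fin e × Fin 3 → Fin (n + 1), ∏ p, (X (g p) : MvPolynomial (Fin (n + 1)) K) =
      monomial (∑ p, Finsupp.single (f p) 1) 1 := ⟨f, prod_X_eq_monomial f⟩
    have h1 : T (∏ p, X (f p)) = r (∑ p, Finsupp.single (f p) 1) := by
      rw [prod_X_eq_monomial]
      have := (basisMonomials (Fin (n + 1)) K).constr_basis K r (∑ p, Finsupp.single (f p) 1)
      rwa [coe_basisMonomials] at this
    obtain ⟨s, hs⟩ := exists_perm_of_prod_X_eq (hex.choose_spec.trans (prod_X_eq_monomial f).symm)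
    rw [h1]
    simp only [r]
    rw [dif_pos hex, hs, mk_tableauProd_comp_perm hJ]
  -- `T` inverts `veroneseHom` modulo `J` on forms of degree `e`.
  have key : T (veroneseHom K n 3 F) = Ideal.Quotient.mk J F := by
    conv_lhs => rw [F.as_sum]
    conv_rhs => rw [F.as_sum]
    simp only [map_sum]
    refine Finset.sum_congr rfl fun m hm => ?_
    obtain ⟨f, hf⟩ := exists_monomial_eq_tableauProd (K := K) m
      (hF.degree_eq_sum_deg_support hm).symm
    have hm : monomial m (coeff m F) = coeff m F • tableauProd K f := by
      rw [← hf, smul_monomial, smul_eq_mul, mul_one]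
    rw [hm, map_smul, map_smul, veroneseHom_tableauProd, hT]
    rfl
  rw [h0, map_zero] at key
  exact Ideal.Quotient.eq_zero_iff_mem.1 key.symm

end

/-! ### Quadratic forms, symmetric matrices and rank. -/

section

variable {K ι : Type*} [Field K]

theorem quadricMatrix_add [DecidableEq ι] (P Q : MvPolynomial ι K) :
    quadricMatrix (P + Q) = quadricMatrix P + quadricMatrix Q := by
  ext i j
  simp only [quadricMatrix, Matrix.of_apply, Matrix.add_apply, coeff_add]
  split_ifs <;> ring

theorem quadricMatrix_smul [DecidableEq ι] (c : K) (Q : MvPolynomial ι K) :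
    quadricMatrix (c • Q) = c • quadricMatrix Q := by
  ext i j
  simp only [quadricMatrix, Matrix.of_apply, Matrix.smul_apply, coeff_smul, smul_eq_mul]
  split_ifs <;> ring

/-- `quadricMatrix` as a linear map. -/
noncomputable def quadricMatrixLin (K ι : Type*) [Field K] [DecidableEq ι] :
    MvPolynomial ι K →ₗ[K] Matrix ι ι K where
  toFun := quadricMatrix
  map_add' := quadricMatrix_add
  map_smul' := quadricMatrix_smul

theorem quadricMatrix_isSymm [DecidableEq ι] (Q : MvPolynomial ι K) :
    (quadricMatrix Q).IsSymm := by
  ext i j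
  simp only [quadricMatrix, Matrix.transpose_apply, Matrix.of_apply]
  by_cases h : i = j
  · simp [h]
  · simp [h, Ne.symm h, add_comm]

/-- The two indicators are added rather than joined by "or": for a = b both contribute, giving the
diagonal entry 1. -/
theorem quadricMatrix_X_mul_X [DecidableEq ι] (h2 : (2 : K) ≠ 0) (a b : ι) :
    quadricMatrix (X a * X b : MvPolynomial ι K) =
      Matrix.of fun i j => ((if i = a ∧ j = b then 1 else 0) + if i = b ∧ j = a then 1 else 0) / 2 := by
  ext i j
  have key : ∀ i j : ι, Finsupp.single a 1 + Finsupp.single b 1 =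
      (Finsupp.single i 1 + Finsupp.single j 1 : ι →₀ ℕ) ↔
      (i = a ∧ j = b) ∨ (i = b ∧ j = a) := by
    intro i j
    constructor
    · intro h
      have h' := congrArg Finsupp.toMultiset h
      simp only [map_add, Finsupp.toMultiset_single, one_smul] at h'
      have : ({a, b} : Multiset ι) = {i, j} := h'
      simp only [Multiset.insert_eq_cons, Multiset.cons_eq_cons, Multiset.singleton_inj] at this
      rcases this with ⟨rfl, rfl⟩ | ⟨_, cs, h1, h2⟩
      · exact Or.inl ⟨rfl, rfl⟩
      · rw [Multiset.singleton_eq_cons_iff] at h1 h2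
        exact Or.inr ⟨h1.1.symm, h2.1⟩
    · rintro (⟨rfl, rfl⟩ | ⟨rfl, rfl⟩)
      · rfl
      · exact add_comm _ _
  have hm : (X a * X b : MvPolynomial ι K) =
      monomial (Finsupp.single a 1 + Finsupp.single b 1) 1 := by
    rw [X, X, monomial_mul, one_mul]
  simp only [quadricMatrix, Matrix.of_apply, hm, coeff_monomial]
  by_cases hij : i = j
  · subst hij
    have : (Finsupp.single i 2 : ι →₀ ℕ) = Finsupp.single i 1 + Finsupp.single i 1 := by
      rw [← Finsupp.single_add]
    rw [if_pos rfl, this]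
    simp only [key]
    by_cases h1 : i = a ∧ i = b
    · rw [if_pos (Or.inl h1), if_pos h1, if_pos h1.symm]; field_simp; norm_num
    · have h1' : ¬ (i = b ∧ i = a) := fun h => h1 h.symm
      simp [h1, h1']
  · rw [if_neg hij]
    simp only [key]
    by_cases h1 : i = a ∧ j = b
    · obtain ⟨rfl, rfl⟩ := h1
      simp [hij]
    · simp [h1]

variable [Fintype ι]

theorem linForm_isHomogeneous (c : ι → K) : (linForm K c).IsHomogeneous 1 := by
  rw [linForm, Fintype.linearCombination_apply]
  refine IsHomogeneous.sum _ _ _ fun i _ => ?_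
  rw [MvPolynomial.smul_eq_C_mul]
  exact isHomogeneous_C_mul_X _ _

theorem linForm_mul_linForm (c d : ι → K) :
    linForm K c * linForm K d = ∑ i, ∑ j, (c i * d j) • (X i * X j : MvPolynomial ι K) := by
  simp only [linForm, Fintype.linearCombination_apply, Finset.sum_mul_sum, smul_mul_smul_comm]

theorem quadricMatrix_linForm_mul [DecidableEq ι] (h2 : (2 : K) ≠ 0) (c d : ι → K) :
    quadricMatrix (linForm K c * linForm K d) =
      Matrix.of fun i j => (c i * d j + c j * d i) / 2 := by
  have : quadricMatrixLin K ι (linForm K c * linForm K d) =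
      ∑ i, ∑ j, (c i * d j) • quadricMatrix (X i * X j : MvPolynomial ι K) := by
    rw [linForm_mul_linForm]
    simp only [map_sum, map_smul]
    rfl
  change quadricMatrixLin K ι _ = _
  rw [this]
  ext i j
  simp only [quadricMatrix_X_mul_X h2, Matrix.sum_apply, Matrix.smul_apply, Matrix.of_apply,
    smul_eq_mul, ← mul_div_assoc, mul_add, add_div, Finset.sum_add_distrib]
  simp [ite_and, Finset.sum_ite_eq, ← Finset.sum_div]

theorem quadricRank_le_three [DecidableEq ι] (h2 : (2 : K) ≠ 0) (a b c : ι → K) :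
    quadricRank (linForm K a * linForm K b - linForm K c ^ 2) ≤ 3 := by
  -- The matrix (abᵀ + baᵀ)/2 - ccᵀ factors through `Fin 3`.
  have hQ : quadricMatrix (linForm K a * linForm K b - linForm K c ^ 2) =
      (Matrix.of fun i => ![a i, b i, c i]) *
        (Matrix.of fun k j => ![b j / 2, a j / 2, - c j] k : Matrix (Fin 3) ι K) := by
    change quadricMatrixLin K ι _ = _
    rw [map_sub, sq]
    change quadricMatrix _ - quadricMatrix _ = _
    rw [quadricMatrix_linForm_mul h2, quadricMatrix_linForm_mul h2]
    ext i j
    simp [Matrix.mul_apply, Fin.sum_univ_three]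
    field_simp
    ring
  rw [quadricRank, hQ]
  exact (Matrix.rank_mul_le_left _ _).trans ((Matrix.rank_le_card_width _).trans (by simp))

theorem eq_sum_quadricMatrix [DecidableEq ι] (h2 : (2 : K) ≠ 0) {Q : MvPolynomial ι K}
    (hQ : Q.IsHomogeneous 2) :
    Q = ∑ i, ∑ j, quadricMatrix Q i j • (X i * X j : MvPolynomial ι K) := by
  let R : MvPolynomial ι K →ₗ[K] MvPolynomial ι K :=
    ∑ i, ∑ j, (Matrix.entryLinearMap K K i j ∘ₗ quadricMatrixLin K ι).smulRight
      (X i * X j : MvPolynomial ι K)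
  suffices h : Q = R Q by
    conv_lhs => rw [h]
    simp [R, LinearMap.sum_apply, quadricMatrixLin]
  -- Both sides are linear, and products of two variables span the forms of degree 2.
  have hX : ∀ a b : ι, R (X a * X b) = X a * X b := by
    intro a b
    have : R (X a * X b) =
        ∑ i, ∑ j, quadricMatrix (X a * X b : MvPolynomial ι K) i j • (X i * X j : MvPolynomial ι K) := by
      simp [R, LinearMap.sum_apply, quadricMatrixLin]
    rw [this]
    simp only [quadricMatrix_X_mul_X h2, Matrix.of_apply, add_div, add_smul,
      Finset.sum_add_distrib, ite_and, ite_div, zero_div, ite_smul, zero_smul]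
    simp only [Finset.sum_ite_eq', Finset.mem_univ, if_true, Finset.sum_const_zero,
      Finset.sum_ite_irrel]
    have := NeZero.mk h2
    rw [mul_comm (X b) (X a), ← add_smul, add_halves, one_smul]
  conv_lhs => rw [Q.as_sum]
  conv_rhs => rw [Q.as_sum, map_sum]
  refine Finset.sum_congr rfl fun m hm => ?_
  have hd : m.degree = 2 := (hQ.degree_eq_sum_deg_support hm).symm
  obtain ⟨g, hg⟩ := exists_monomial_eq_prod_X (K := K) m hd
  have h : monomial m (coeff m Q) = coeff m Q • (X (g 0) * X (g 1)) := by
    rw [← Fin.prod_univ_two fun i => X (g i), ← hg, smul_monomial, smul_eq_mul, mul_one]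
  rw [h, map_smul, hX]

/-- An orthogonal basis for the bilinear form of `M` gives the columns of `P`, and PᵀMP is diagonal;
`C` is the inverse transpose of `P`. -/
theorem exists_eq_diagonal_of_isSymm [DecidableEq ι] (h2 : (2 : K) ≠ 0) {M : Matrix ι ι K}
    (hM : M.IsSymm) :
    ∃ (r : ℕ) (C : Matrix ι (Fin r) K) (D : Fin r → K),
      M = C * Matrix.diagonal D * C.transpose ∧ (Matrix.diagonal D).rank ≤ M.rank := by
  have := invertibleOfNonzero h2
  obtain ⟨v, hv⟩ := LinearMap.BilinForm.exists_orthogonal_basis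
    (LinearMap.BilinForm.isSymm_iff.1 (Matrix.isSymm_toBilin'_iff_isSymm.2 hM))
  set B := M.toBilin' with hB
  let P : Matrix ι (Fin (Module.finrank K (ι → K))) K := Matrix.of fun i k => v k i
  let C : Matrix ι (Fin (Module.finrank K (ι → K))) K :=
    Matrix.of fun i k => v.repr (Pi.single i 1) k
  have hD : P.transpose * M * P = Matrix.diagonal fun k => B (v k) (v k) := by
    ext k l
    have hkl : (P.transpose * M * P) k l = B (v k) (v l) := by
      rw [hB, Matrix.toBilin'_apply', Matrix.mul_assoc, Matrix.mul_apply']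
      rfl
    rw [hkl]
    by_cases h : k = l
    · subst h; simp
    · rw [Matrix.diagonal_apply_ne _ h]; exact hv h
  refine ⟨_, C, fun k => B (v k) (v k), ?_, ?_⟩
  · have hCP : P * C.transpose = 1 := by
      ext i j
      have := congrFun (v.sum_repr (Pi.single j 1)) i
      rw [Finset.sum_apply] at this
      rw [Matrix.mul_apply, Matrix.one_apply]
      simp only [P, C, Matrix.of_apply, Matrix.transpose_apply]
      rw [Pi.single_apply] at this
      rw [← this]
      exact Finset.sum_congr rfl fun k _ => by simp [mul_comm]
    have hPC : C * P.transpose = 1 := by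
      have := congrArg Matrix.transpose hCP
      simpa using this
    rw [← hD]
    calc M = (C * P.transpose) * M * (P * C.transpose) := by rw [hCP, hPC]; simp
      _ = _ := by simp only [Matrix.mul_assoc]
  · rw [← hD]
    exact (Matrix.rank_mul_le_left _ _).trans (Matrix.rank_mul_le_right _ _)

/-- Over an algebraically closed field, a quadratic form of rank at most `2` is a product of two
linear forms. -/
theorem exists_linForm_mul_of_quadricRank_le_two [DecidableEq ι] [IsAlgClosed K] (h2 : (2 : K) ≠ 0)
    {Q : MvPolynomial ι K} (hQ : Q.IsHomogeneous 2) (hr : quadricRank Q ≤ 2) :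
    ∃ c d : ι → K, Q = linForm K c * linForm K d := by
  classical
  obtain ⟨r, C, D, hM, hD⟩ := exists_eq_diagonal_of_isSymm h2 (quadricMatrix_isSymm Q)
  have hM' : ∀ i j, quadricMatrix Q i j = ∑ k, C i k * D k * C j k := by
    intro i j
    rw [hM, Matrix.mul_apply]
    simp only [Matrix.mul_diagonal, Matrix.transpose_apply]
  have hQ' : Q = ∑ k, D k • (linForm K (fun i => C i k) * linForm K fun i => C i k) := by
    conv_lhs => rw [eq_sum_quadricMatrix h2 hQ]
    simp only [linForm_mul_linForm, Finset.smul_sum, hM', Finset.sum_smul]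
    rw [Finset.sum_comm_cycle]
    refine Finset.sum_congr rfl fun k _ => ?_
    refine Finset.sum_congr rfl fun i _ => Finset.sum_congr rfl fun j _ => ?_
    rw [smul_smul]; congr 1; ring
  rw [Matrix.rank_diagonal, Fintype.card_subtype] at hD
  have hcard := hD.trans hr
  set s := Finset.univ.filter fun k => D k ≠ 0 with hs
  have hQs : Q = ∑ k ∈ s, D k • (linForm K (fun i => C i k) * linForm K fun i => C i k) := by
    rw [hQ', hs, Finset.sum_filter_of_ne]
    intro k _ h h0
    exact h (by rw [h0, zero_smul])
  have hcases : s.card = 0 ∨ s.card = 1 ∨ s.card = 2 := by omega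
  rcases hcases with h | h | h
  · rw [Finset.card_eq_zero] at h
    exact ⟨0, 0, by rw [hQs, h]; simp⟩
  · obtain ⟨k, hk⟩ := Finset.card_eq_one.1 h
    refine ⟨D k • fun i => C i k, fun i => C i k, ?_⟩
    rw [hQs, hk, Finset.sum_singleton, map_smul, smul_mul_assoc]
  -- With a² = D k and b² = -D l, the form is a difference of two squares.
  · obtain ⟨k, l, hkl, hk⟩ := Finset.card_eq_two.1 h
    obtain ⟨a, ha⟩ := IsAlgClosed.exists_pow_nat_eq (D k) two_pos
    obtain ⟨b, hb⟩ := IsAlgClosed.exists_pow_nat_eq (-D l) two_pos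
    refine ⟨a • (fun i => C i k) + b • fun i => C i l,
      a • (fun i => C i k) - b • fun i => C i l, ?_⟩
    rw [hQs, hk, Finset.sum_pair hkl, map_add, map_sub, map_smul, map_smul, ← ha,
      show D l = -b ^ 2 by rw [hb, neg_neg]]
    simp only [MvPolynomial.smul_eq_C_mul, map_neg, map_pow]
    ring

end

/-! ### The rank index of the cubic Veronese variety. -/

theorem veroneseHom_linForm_eq_zero {K : Type*} [Field K] {n d : ℕ} {c : VeroneseIndex n d → K}
    (h : veroneseHom K n d (linForm K c) = 0) : c = 0 := by
  classical
  funext I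
  have := congrArg (coeff (Finsupp.equivFunOnFinite.symm I.1)) h
  simp only [linForm, Fintype.linearCombination_apply, map_sum, map_smul, veroneseHom, aeval_X,
    coeff_sum, coeff_smul, coeff_monomial, coeff_zero, EmbeddingLike.apply_eq_iff_eq,
    Subtype.val_inj, smul_eq_mul, mul_ite, mul_one, mul_zero] at this
  simpa using this

theorem rankThreeQuadric_isHomogeneous {K : Type*} [Field K] {n : ℕ}
    (s t h : MvPolynomial (Fin (n + 1)) K) : (rankThreeQuadric s t h).IsHomogeneous 2 := by
  rw [rankThreeQuadric, sq]
  exact ((linForm_isHomogeneous _).mul (linForm_isHomogeneous _)).sub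
    ((linForm_isHomogeneous _).mul (linForm_isHomogeneous _))

theorem quadricRank_rankThreeQuadric_le {K : Type*} [Field K] (h2 : (2 : K) ≠ 0) {n : ℕ}
    (s t h : MvPolynomial (Fin (n + 1)) K) : quadricRank (rankThreeQuadric s t h) ≤ 3 :=
  quadricRank_le_three h2 _ _ _

theorem veroneseHom_rankThreeQuadric {K : Type*} [Field K] {n : ℕ}
    {s t h : MvPolynomial (Fin (n + 1)) K} (hs : s.IsHomogeneous 1) (ht : t.IsHomogeneous 1)
    (hh : h.IsHomogeneous 1) : veroneseHom K n 3 (rankThreeQuadric s t h) = 0 := by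
  rw [rankThreeQuadric, map_sub, map_pow, map_mul, veroneseHom_formOf ((hs.mul hs).mul hh),
    veroneseHom_formOf ((ht.mul ht).mul hh), veroneseHom_formOf ((hs.mul ht).mul hh)]
  ring

theorem propertyQR_three_veroneseVariety (K : Type*) [Field K] [IsAlgClosed K] [CharP K 3]
    (n : ℕ) : PropertyQR (veroneseVariety K n 3) 3 := by
  have h2 : (2 : K) ≠ 0 := Ring.two_ne_zero (by rw [ringChar.eq K 3]; norm_num)
  refine ⟨{Q | ∃ s t h : MvPolynomial (Fin (n + 1)) K, s.IsHomogeneous 1 ∧ t.IsHomogeneous 1 ∧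
    h.IsHomogeneous 1 ∧ rankThreeQuadric s t h = Q}, ?_, le_antisymm ?_ ?_⟩
  · rintro _ ⟨s, t, h, -, -, -, rfl⟩
    exact ⟨rankThreeQuadric_isHomogeneous s t h, quadricRank_rankThreeQuadric_le h2 s t h⟩
  · refine Ideal.span_le.2 ?_
    rintro F ⟨⟨e, he⟩, hF⟩
    refine mem_of_veroneseHom_eq_zero (fun s hs t ht h hh => ?_) he
      ((veroneseHom_eq_zero_iff three_ne_zero F).2 hF)
    exact Ideal.subset_span ⟨s, t, h, hs, ht, hh, rfl⟩
  · refine Ideal.span_le.2 ?_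
    rintro _ ⟨s, t, h, hs, ht, hh, rfl⟩
    exact Ideal.subset_span ⟨⟨2, rankThreeQuadric_isHomogeneous s t h⟩,
      (veroneseHom_eq_zero_iff three_ne_zero _).1 (veroneseHom_rankThreeQuadric hs ht hh)⟩

/-- The homogeneous ideal of a Veronese variety contains no nonzero quadric of rank at most `2`. -/
theorem eq_zero_of_quadricRank_le_two {K : Type*} [Field K] [IsAlgClosed K] (h2 : (2 : K) ≠ 0)
    {n d : ℕ} {Q : MvPolynomial (VeroneseIndex n d) K} (hQ : Q.IsHomogeneous 2)
    (hr : quadricRank Q ≤ 2) (h0 : veroneseHom K n d Q = 0) : Q = 0 := by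
  obtain ⟨a, b, rfl⟩ := exists_linForm_mul_of_quadricRank_le_two h2 hQ hr
  rw [map_mul, mul_eq_zero] at h0
  rcases h0 with h | h
  · rw [veroneseHom_linForm_eq_zero h]; simp
  · rw [veroneseHom_linForm_eq_zero h]; simp

theorem rankThreeQuadric_X_ne_zero {K : Type*} [Field K] {n : ℕ} {i j : Fin (n + 1)}
    (hij : i ≠ j) : rankThreeQuadric (X i) (X j) (X i : MvPolynomial (Fin (n + 1)) K) ≠ 0 := by
  classical
  intro h
  have hmon : ∀ a b c : Fin (n + 1), ∃ I : VeroneseIndex n 3,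
      (I.1 = ⇑(Finsupp.single a 1 + Finsupp.single b 1 + Finsupp.single c 1 : Fin (n + 1) →₀ ℕ)) ∧
      formOf K n 3 (X a * X b * X c) = X I := by
    intro a b c
    refine ⟨⟨⇑(Finsupp.single a 1 + Finsupp.single b 1 + Finsupp.single c 1 :
      Fin (n + 1) →₀ ℕ), ?_⟩, rfl, ?_⟩
    · rw [← Finsupp.degree_eq_sum]; simp
    · rw [X, X, X, monomial_mul, monomial_mul, one_mul, one_mul]
      have := formOf_monomial (K := K) (⟨⇑(Finsupp.single a 1 + Finsupp.single b 1 +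
        Finsupp.single c 1 : Fin (n + 1) →₀ ℕ), by rw [← Finsupp.degree_eq_sum]; simp⟩ :
          VeroneseIndex n 3) 1
      rw [Finsupp.equivFunOnFinite_symm_coe, C_1, one_mul] at this
      exact this
  obtain ⟨I₁, h₁, e₁⟩ := hmon i i i
  obtain ⟨I₂, h₂, e₂⟩ := hmon j j i
  obtain ⟨I₃, h₃, e₃⟩ := hmon i j i
  have h13 : I₁ ≠ I₃ := by
    rintro rfl
    have := congrFun (h₁.symm.trans h₃) j
    simp [hij] at this
  rw [rankThreeQuadric, e₁, e₂, e₃] at h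
  -- At the point with only the coordinate `I₃` nonzero, the first product vanishes because `I₁ ≠
  -- I₃`, while the square is 1.
  have := congrArg (eval fun I => if I = I₃ then (1 : K) else 0) h
  simp [h13] at this

theorem not_propertyQR_two_veroneseVariety (K : Type*) [Field K] [IsAlgClosed K] (h2 : (2 : K) ≠ 0)
    {n m : ℕ} (hn : 1 ≤ n) (hm : m ≤ 2) : ¬ PropertyQR (veroneseVariety K n 3) m := by
  rintro ⟨S, hS, hI⟩
  have hS0 : Ideal.span S = ⊥ := by
    rw [Ideal.span_eq_bot]
    intro Q hQ
    refine eq_zero_of_quadricRank_le_two h2 (hS Q hQ).1 ((hS Q hQ).2.trans hm) ?_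
    exact homogeneousIdealOf_le_ker three_ne_zero (hI ▸ Ideal.subset_span hQ)
  have h01 : (0 : Fin (n + 1)) ≠ Fin.last n := by
    rw [Ne, Fin.ext_iff, Fin.val_zero, Fin.val_last]; omega
  refine rankThreeQuadric_X_ne_zero (K := K) h01 ?_
  rw [← Ideal.mem_bot, ← hS0, ← hI]
  exact Ideal.subset_span ⟨⟨2, rankThreeQuadric_isHomogeneous _ _ _⟩,
    (veroneseHom_eq_zero_iff three_ne_zero _).1 (veroneseHom_rankThreeQuadric
      (isHomogeneous_X _ _) (isHomogeneous_X _ _) (isHomogeneous_X _ _))⟩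

theorem proposition3p1 (K : Type*) [Field K] [IsAlgClosed K] [CharP K 3] (n : ℕ) (hn : 1 ≤ n) :
    HasRankIndex (veroneseVariety K n 3) 3 := by
  refine ⟨propertyQR_three_veroneseVariety K n, fun m hm => ?_⟩
  by_contra hlt
  have h2 : (2 : K) ≠ 0 := Ring.two_ne_zero (by rw [ringChar.eq K 3]; norm_num)
  exact not_propertyQR_two_veroneseVariety K h2 hn (by omega) hm
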